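/- Let $X$ be a compact connected Riemann surface, let $\Gamma$ be a finite group acting on $X$ on the right by holomorphic automorphisms, and let $G$ be an abelian connected reductive complex Lie group, i.e. $G\cong(\mathbb C^*)^p$ for some $p\ge 0$. Let $\theta:\Gamma\to\operatorname{Aut}(G)$, $\gamma\mapsto\theta_\gamma$, be a homomorphism to the group of holomorphic automorphisms of $G$, and let $c:\Gamma\times\Gamma\to G$ be a 2-cocycle, i.e. $c(\gamma,1)=c(1,\gamma)=1$ and $\theta_{\gamma_0}(c(\gamma_1,\gamma_2))\,c(\gamma_0,\gamma_1\gamma_2)=c(\gamma_0,\gamma_1)\,c(\gamma_0\gamma_1,\gamma_2)$. Let $\pi:Q\to X$ be a holomorphic principal $G$-bundle. A $(\theta,c)$-twisted $\Gamma$-equivariant structure on $Q$ is a holomorphic map $Q\times\Gamma\to Q$, $(q,\gamma)\mapsto q\bullet\gamma$, such that for all $q\in Q$, $g\in G$, $\gamma,\gamma'\in\Gamma$ $$q\bullet 1=q,\quad (qg)\bullet\gamma=(q\bullet\gamma)\,\theta_\gamma^{-1}(g),\quad (q\bullet\gamma)\bullet\gamma'=(q\,c(\gamma,\gamma'))\bullet(\gamma\gamma'),\quad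 \pi(q\bullet\gamma)=\pi(q)\cdot\gamma .$$ Two such structures are isomorphic if some holomorphic automorphism of the $G$-bundle $Q$ (over the identity of $X$) intertwines them. Let $Z^1_\theta(\Gamma,G)$ be the group of maps $\kappa:\Gamma\to G$ with $\kappa(\gamma_1\gamma_2)=\kappa(\gamma_1)\theta_{\gamma_1}(\kappa(\gamma_2))$, and let $H^1_\theta(\Gamma,G)$ be its quotient by the action $(\kappa\cdot g)(\gamma)=g^{-1}\kappa(\gamma)\theta_\gamma(g)$ of $G$, i.e. by the subgroup of the maps $\gamma\mapsto g^{-1}\theta_\gamma(g)$, $g\in G$. Then the set of isomorphism classes of $(\theta,c)$-twisted $\Gamma$-equivariant structures on $Q$ is either empty or a torsor under $H^1_\theta(\Gamma,G)$. The action is the one for which the class of $\kappa\in Z^1_\theta(\Gamma,G)$ sends the class of $\bullet$ to the class of the structure $*$ given by $q*\gamma=(q\,\kappa(\gamma))\bullet\gamma$. -/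

import Mathlib

open scoped Manifold ContDiff RightActions

noncomputable section

namespace TwistedEquivariant

section Cohomology

variable {Γ G : Type*} [Group Γ] [CommGroup G] (θ : Γ →* MulAut G)

/-- Normalized 2-cocycles of `Γ` with values in the abelian group `G`, on which `Γ` acts
through `θ`. -/
structure IsTwoCocycle (c : Γ → Γ → G) : Prop where
  one_right : ∀ γ, c γ 1 = 1
  one_left : ∀ γ, c 1 γ = 1
  cocycle : ∀ γ₀ γ₁ γ₂,
    θ γ₀ (c γ₁ γ₂) * c γ₀ (γ₁ * γ₂) = c γ₀ γ₁ * c (γ₀ * γ₁) γ₂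

/-- The group `Z¹_θ(Γ, G)` of 1-cocycles, under pointwise multiplication. -/
def Z1 : Subgroup (Γ → G) where
  carrier := {κ | ∀ γ₁ γ₂, κ (γ₁ * γ₂) = κ γ₁ * θ γ₁ (κ γ₂)}
  mul_mem' := by
    intro a b ha hb γ₁ γ₂
    simp only [Set.mem_ofPred_eq] at ha hb
    simp only [Pi.mul_apply, ha γ₁ γ₂, hb γ₁ γ₂, map_mul]
    exact mul_mul_mul_comm _ _ _ _
  one_mem' := by
    intro γ₁ γ₂
    simp
  inv_mem' := by
    intro a ha γ₁ γ₂
    simp only [Set.mem_ofPred_eq] at ha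
    simp only [Pi.inv_apply, ha γ₁ γ₂, map_inv, mul_inv]

/-- The 1-coboundary `γ ↦ g⁻¹ θ_γ(g)` of an element `g` of `G`. -/
def coboundary : G →* Z1 θ where
  toFun g := ⟨fun γ => g⁻¹ * θ γ g, by
    intro γ₁ γ₂
    simp only [map_mul, map_inv, MulAut.mul_apply]
    group⟩
  map_one' := by
    ext γ
    simp
  map_mul' a b := by
    ext γ
    simp only [map_mul, mul_inv, Subgroup.coe_mul, Pi.mul_apply]
    exact mul_mul_mul_comm _ _ _ _

/-- The first cohomology group `H¹_θ(Γ, G)`. Since `G` is abelian, the orbits of the action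
`(κ · g)(γ) = g⁻¹ κ(γ) θ_γ(g)` of `G` on `Z¹_θ(Γ, G)` are the cosets of the subgroup of
coboundaries, see `H1.mk_eq_mk_iff`. -/
abbrev H1 : Type _ := Z1 θ ⧸ (coboundary θ).range

/-- The class of a 1-cocycle. -/
def H1.mk (κ : Z1 θ) : H1 θ := QuotientGroup.mk κ

theorem H1.mk_eq_mk_iff (κ κ' : Z1 θ) :
    H1.mk θ κ = H1.mk θ κ' ↔ ∃ g : G, ∀ γ, κ'.1 γ = g⁻¹ * κ.1 γ * θ γ g := by
  unfold H1.mk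
  rw [QuotientGroup.eq]
  constructor
  · rintro ⟨g, hg⟩
    refine ⟨g, fun γ => ?_⟩
    have h : g⁻¹ * θ γ g = (κ.1 γ)⁻¹ * κ'.1 γ := congrFun (congrArg Subtype.val hg) γ
    rw [mul_right_comm, h, mul_comm, mul_inv_cancel_left]
  · rintro ⟨g, hg⟩
    refine ⟨g, ?_⟩
    ext γ
    change g⁻¹ * θ γ g = (κ.1 γ)⁻¹ * κ'.1 γ
    rw [hg γ, mul_right_comm, mul_comm _ (κ.1 γ), inv_mul_cancel_left]

end Cohomology

section Bundles

variable {F : Type*} [NormedAddCommGroup F] [NormedSpace ℂ F]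
  {X : Type*} {Γ : Type*} [Group Γ] [MulAction Γᵐᵒᵖ X] {G : Type*} [CommGroup G]
  {Q : Type*} [TopologicalSpace Q] [ChartedSpace F Q] [MulAction Gᵐᵒᵖ Q]

/-- The complex Lie group `G` is isomorphic to `(ℂ*)ᵖ`, for some `p`: there is a biholomorphic
isomorphism of groups. The group `(ℂ*)ᵖ` is the group of units of the algebra `ℂᵖ`. -/
def IsComplexTorus (E G : Type*) [NormedAddCommGroup E] [NormedSpace ℂ E]
    [TopologicalSpace G] [ChartedSpace E G] [CommGroup G] : Prop :=
  ∃ (p : ℕ) (φ : G ≃* (Fin p → ℂ)ˣ),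
    ContMDiff 𝓘(ℂ, E) 𝓘(ℂ, Fin p → ℂ) ω φ ∧ ContMDiff 𝓘(ℂ, Fin p → ℂ) 𝓘(ℂ, E) ω φ.symm

/-- `π : Q → X` is a holomorphic principal `G`-bundle, for the right action `q <• g` of `G` on
the complex manifold `Q`. -/
structure IsHolomorphicPrincipalBundle (E F G : Type*) [NormedAddCommGroup E] [NormedSpace ℂ E]
    [NormedAddCommGroup F] [NormedSpace ℂ F]
    [TopologicalSpace G] [ChartedSpace E G] [CommGroup G]
    {X : Type*} [TopologicalSpace X] [ChartedSpace ℂ X]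
    {Q : Type*} [TopologicalSpace Q] [ChartedSpace F Q] [MulAction Gᵐᵒᵖ Q]
    (π : Q → X) : Prop where
  holomorphic_proj : ContMDiff 𝓘(ℂ, F) 𝓘(ℂ) ω π
  holomorphic_smul :
    ContMDiff (𝓘(ℂ, F).prod 𝓘(ℂ, E)) 𝓘(ℂ, F) ω (fun a : Q × G => a.1 <• a.2)
  proj_smul : ∀ (q : Q) (g : G), π (q <• g) = π q
  /-- Around every point there is a `G`-equivariant biholomorphic trivialization. -/
  locally_trivial : ∀ x : X, ∃ (U : Set X) (Φ : OpenPartialHomeomorph Q (X × G)),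
    IsOpen U ∧ x ∈ U ∧ Φ.source = π ⁻¹' U ∧ Φ.target = U ×ˢ Set.univ ∧
    ContMDiffOn 𝓘(ℂ, F) (𝓘(ℂ).prod 𝓘(ℂ, E)) ω Φ Φ.source ∧
    ContMDiffOn (𝓘(ℂ).prod 𝓘(ℂ, E)) 𝓘(ℂ, F) ω Φ.symm Φ.target ∧
    (∀ q ∈ Φ.source, (Φ q).1 = π q) ∧
    (∀ q ∈ Φ.source, ∀ g : G, (Φ (q <• g)).2 = (Φ q).2 * g)

/-- A `(θ, c)`-twisted `Γ`-equivariant structure on `π : Q → X`: a holomorphic map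
`Q × Γ → Q`, where `Γ` is discrete, with the twisted equivariance properties. -/
@[ext]
structure TwistedStructure (F : Type*) [NormedAddCommGroup F] [NormedSpace ℂ F]
    {X Γ G Q : Type*} [Group Γ] [MulAction Γᵐᵒᵖ X] [CommGroup G]
    [TopologicalSpace Q] [ChartedSpace F Q] [MulAction Gᵐᵒᵖ Q]
    (π : Q → X) (θ : Γ →* MulAut G) (c : Γ → Γ → G) where
  act : Q → Γ → Q
  holomorphic : ∀ γ, ContMDiff 𝓘(ℂ, F) 𝓘(ℂ, F) ω (fun q => act q γ)
  act_one : ∀ q, act q 1 = q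
  act_smul : ∀ (q : Q) (g : G) (γ : Γ), act (q <• g) γ = act q γ <• (θ γ)⁻¹ g
  act_act : ∀ (q : Q) (γ γ' : Γ), act (act q γ) γ' = act (q <• c γ γ') (γ * γ')
  proj_act : ∀ (q : Q) (γ : Γ), π (act q γ) = π q <• γ

/-- Two twisted equivariant structures on `π : Q → X` are isomorphic if there is an
automorphism of the holomorphic `G`-bundle `Q` over the identity of `X` which intertwines
them. -/
def TwistedStructure.Isomorphic {π : Q → X} {θ : Γ →* MulAut G} {c : Γ → Γ → G}
    (s t : TwistedStructure F π θ c) : Prop :=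
  ∃ f : Q ≃ₘ^ω⟮𝓘(ℂ, F), 𝓘(ℂ, F)⟯ Q,
    (∀ q, π (f q) = π q) ∧ (∀ (q : Q) (g : G), f (q <• g) = f q <• g) ∧
    ∀ (q : Q) (γ : Γ), f (s.act q γ) = t.act (f q) γ

/-- Isomorphism of twisted equivariant structures is an equivalence relation. -/
def TwistedStructure.setoid (F : Type*) [NormedAddCommGroup F] [NormedSpace ℂ F]
    {X Γ G Q : Type*} [Group Γ] [MulAction Γᵐᵒᵖ X] [CommGroup G]
    [TopologicalSpace Q] [ChartedSpace F Q] [MulAction Gᵐᵒᵖ Q]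
    (π : Q → X) (θ : Γ →* MulAut G) (c : Γ → Γ → G) : Setoid (TwistedStructure F π θ c) where
  r := TwistedStructure.Isomorphic
  iseqv :=
    { refl := fun s => ⟨Diffeomorph.refl _ _ _, fun _ => rfl, fun _ _ => rfl, fun _ _ => rfl⟩
      symm := by
        rintro s t ⟨f, h1, h2, h3⟩
        refine ⟨f.symm, fun q => ?_, fun q g => ?_, fun q γ => ?_⟩
        · rw [← h1, f.apply_symm_apply]
        · apply f.injective
          change f (f.symm (q <• g)) = f (f.symm q <• g)
          rw [f.apply_symm_apply, h2, f.apply_symm_apply]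
        · apply f.injective
          change f (f.symm (t.act q γ)) = f (s.act (f.symm q) γ)
          rw [f.apply_symm_apply, h3, f.apply_symm_apply]
      trans := by
        rintro s t u ⟨f, h1, h2, h3⟩ ⟨f', h1', h2', h3'⟩
        refine ⟨f.trans f', fun q => ?_, fun q g => ?_, fun q γ => ?_⟩
        · simp [h1, h1']
        · simp [h2, h2']
        · simp [h3, h3'] }

/-- The set of isomorphism classes of `(θ, c)`-twisted `Γ`-equivariant structures on `Q`. -/
def IsoClasses (F : Type*) [NormedAddCommGroup F] [NormedSpace ℂ F]
    {X Γ G Q : Type*} [Group Γ] [MulAction Γᵐᵒᵖ X] [CommGroup G]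
    [TopologicalSpace Q] [ChartedSpace F Q] [MulAction Gᵐᵒᵖ Q]
    (π : Q → X) (θ : Γ →* MulAut G) (c : Γ → Γ → G) : Type _ :=
  Quotient (TwistedStructure.setoid F π θ c)

/-- The isomorphism class of a twisted equivariant structure. -/
def IsoClasses.mk {π : Q → X} {θ : Γ →* MulAut G} {c : Γ → Γ → G}
    (s : TwistedStructure F π θ c) : IsoClasses F π θ c :=
  Quotient.mk (TwistedStructure.setoid F π θ c) s

end Bundles

end TwistedEquivariant

end

namespace TwistedEquivariant

open MulOpposite

/-! Two structures `s`, `t` on `Q` differ, for each `γ`, by a constant of `G`. Indeed `t.act · γ`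
and `s.act · γ` cover the same map of `X`, so they differ by a function `d : Q → G`, holomorphic
because trivializations are. Both transform through `(θ γ)⁻¹` and `G` is abelian, so `d` is
`G`-invariant and descends to a holomorphic map `X → (ℂ*)ᵖ`, which is constant since `X` is compact
and connected (`exists_const_eq_smul`). Moved inside the action, these constants form a map `κ`;
comparing the two twisted associativity laws cancels `c` and leaves the 1-cocycle identity, whence
transitivity. The same lemma, applied to a bundle automorphism and the identity, shows that every
automorphism is translation by some `g`. It intertwines the twists by `κ` and `κ'` exactly when
`κ'(γ) = g⁻¹ κ(γ) θ_γ(g)`, so the action of `H1 θ` is well defined and free. -/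

theorem op_smul_mul {G Q : Type*} [Monoid G] [MulAction Gᵐᵒᵖ Q] (q : Q) (g h : G) :
    q <• (g * h) = (q <• g) <• h := by
  rw [op_mul, mul_smul]

theorem Z1.map_mul {Γ G : Type*} [Group Γ] [CommGroup G] {θ : Γ →* MulAut G} (κ : Z1 θ)
    (γ γ' : Γ) :
    κ.1 (γ * γ') = κ.1 γ * θ γ (κ.1 γ') := κ.2 γ γ'

theorem Z1.map_one {Γ G : Type*} [Group Γ] [CommGroup G] {θ : Γ →* MulAut G} (κ : Z1 θ) :
    κ.1 1 = 1 := by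
  have h := Z1.map_mul κ 1 1
  rwa [mul_one, _root_.map_one, MulAut.one_apply, left_eq_mul] at h

/-! ### Holomorphic maps from a compact base to a torus -/

section Constancy

variable {X : Type*} [TopologicalSpace X] [ChartedSpace ℂ X] [IsManifold 𝓘(ℂ) ω X]
  [CompactSpace X] [ConnectedSpace X]
  {E : Type*} [NormedAddCommGroup E] [NormedSpace ℂ E]
  {G : Type*} [TopologicalSpace G] [ChartedSpace E G] [CommGroup G]

/-- A holomorphic map from a compact connected complex manifold to a complex torus `(ℂ*)ᵖ` is
constant. -/
theorem IsComplexTorus.apply_eq_of_contMDiff (hG : IsComplexTorus E G) {u : X → G}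
    (hu : ContMDiff 𝓘(ℂ) 𝓘(ℂ, E) ω u) (x y : X) : u x = u y := by
  obtain ⟨p, φ, hφ, -⟩ := hG
  have : IsManifold 𝓘(ℂ) 1 X := IsManifold.of_le (n := ω) le_top
  have h : ContMDiff 𝓘(ℂ) 𝓘(ℂ, Fin p → ℂ) ω fun x => ((φ (u x) : (Fin p → ℂ)ˣ) : Fin p → ℂ) :=
    Units.contMDiff_val.comp (hφ.comp hu)
  have h' := (h.mdifferentiable (by simp)).apply_eq_of_compactSpace x y
  exact φ.injective (Units.ext h')

end Constancy

/-! ### Differences of maps into a principal bundle -/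

section Bundle

variable {X : Type*} [TopologicalSpace X] [ChartedSpace ℂ X]
  {E : Type*} [NormedAddCommGroup E] [NormedSpace ℂ E]
  {G : Type*} [TopologicalSpace G] [ChartedSpace E G] [CommGroup G]
  {F : Type*} [NormedAddCommGroup F] [NormedSpace ℂ F]
  {Q : Type*} [TopologicalSpace Q] [ChartedSpace F Q] [MulAction Gᵐᵒᵖ Q]
  {π : Q → X}

namespace IsHolomorphicPrincipalBundle

theorem smul_left_injective (hπ : IsHolomorphicPrincipalBundle E F G π) (q : Q) :
    Function.Injective fun g : G => q <• g := by
  intro g h hgh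
  obtain ⟨U, Φ, -, hxU, hs, -, -, -, -, hΦ⟩ := hπ.locally_trivial (π q)
  have hq : q ∈ Φ.source := by rw [hs]; exact hxU
  have := congrArg (fun q => (Φ q).2) hgh
  simpa only [hΦ q hq, mul_right_inj] using this

theorem surjective (hπ : IsHolomorphicPrincipalBundle E F G π) : Function.Surjective π := by
  intro x
  obtain ⟨U, Φ, -, hxU, -, ht, -, -, hΦ, -⟩ := hπ.locally_trivial x
  have h : (x, (1 : G)) ∈ Φ.target := by rw [ht]; exact ⟨hxU, trivial⟩
  exact ⟨Φ.symm (x, 1), by rw [← hΦ _ (Φ.map_target h), Φ.right_inv h]⟩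

theorem contMDiff_smul_const (hπ : IsHolomorphicPrincipalBundle E F G π) (g : G) :
    ContMDiff 𝓘(ℂ, F) 𝓘(ℂ, F) ω fun q : Q => q <• g :=
  hπ.holomorphic_smul.comp (contMDiff_id.prodMk contMDiff_const)

/-- Two points in a fibre differ by the quotient of their coordinates in a trivialization. -/
theorem eq_smul_of_trivialization {Φ : OpenPartialHomeomorph Q (X × G)} {U : Set X}
    (hπ : IsHolomorphicPrincipalBundle E F G π) (hs : Φ.source = π ⁻¹' U)
    (h1 : ∀ q ∈ Φ.source, (Φ q).1 = π q)
    (h2 : ∀ q ∈ Φ.source, ∀ g : G, (Φ (q <• g)).2 = (Φ q).2 * g)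
    {a b : Q} (hab : π a = π b) (hb : π b ∈ U) : a = b <• ((Φ b).2⁻¹ * (Φ a).2) := by
  have hb' : b ∈ Φ.source := by rw [hs]; exact hb
  have ha' : a ∈ Φ.source := by rw [hs, Set.mem_preimage, hab]; exact hb
  have hc' : b <• ((Φ b).2⁻¹ * (Φ a).2) ∈ Φ.source := by
    rw [hs, Set.mem_preimage, hπ.proj_smul]; exact hb
  refine Φ.injOn ha' hc' (Prod.ext ?_ ?_)
  · rw [h1 _ ha', h1 _ hc', hπ.proj_smul, hab]
  · rw [h2 _ hb', mul_inv_cancel_left]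

theorem exists_eq_smul (hπ : IsHolomorphicPrincipalBundle E F G π) {a b : Q}
    (hab : π a = π b) : ∃ g : G, a = b <• g := by
  obtain ⟨U, Φ, -, hxU, hs, -, -, -, h1, h2⟩ := hπ.locally_trivial (π b)
  exact ⟨_, hπ.eq_smul_of_trivialization hs h1 h2 hab hxU⟩

/-- The difference of two holomorphic maps to `Q` over the same map to `X` is holomorphic. -/
theorem contMDiff_of_eq_smul [LieGroup 𝓘(ℂ, E) ω G]
    (hπ : IsHolomorphicPrincipalBundle E F G π) {a b : Q → Q} {d : Q → G}
    (ha : ContMDiff 𝓘(ℂ, F) 𝓘(ℂ, F) ω a) (hb : ContMDiff 𝓘(ℂ, F) 𝓘(ℂ, F) ω b)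
    (hd : ∀ q, a q = b q <• d q) : ContMDiff 𝓘(ℂ, F) 𝓘(ℂ, E) ω d := by
  intro q
  obtain ⟨U, Φ, -, hxU, hs, -, hΦ, -, h1, h2⟩ := hπ.locally_trivial (π (b q))
  have hab (q : Q) : π (a q) = π (b q) := by rw [hd, hπ.proj_smul]
  have hbq : b q ∈ Φ.source := by rw [hs]; exact hxU
  have haq : a q ∈ Φ.source := by rw [hs, Set.mem_preimage, hab]; exact hxU
  have hΦa := (hΦ.contMDiffAt (Φ.open_source.mem_nhds haq)).snd.comp q ha.contMDiffAt
  have hΦb := (hΦ.contMDiffAt (Φ.open_source.mem_nhds hbq)).snd.comp q hb.contMDiffAt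
  -- Near `q`, `d` is the quotient of the fibre coordinates of `a` and `b` in a single
  -- trivialization.
  refine (hΦb.inv.mul hΦa).congr_of_eventuallyEq ?_
  filter_upwards [hb.continuous.continuousAt.preimage_mem_nhds (Φ.open_source.mem_nhds hbq)]
    with q' hq'
  refine hπ.smul_left_injective (b q') ?_
  have hU : π (b q') ∈ U := by rw [Set.mem_preimage, hs] at hq'; exact hq'
  exact (hd q').symm.trans (hπ.eq_smul_of_trivialization hs h1 h2 (hab q') hU)

/-- A `G`-invariant holomorphic map on `Q` descends to a holomorphic map on `X`. -/
theorem exists_contMDiff_comp_proj (hπ : IsHolomorphicPrincipalBundle E F G π)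
    {d : Q → G} (hd : ContMDiff 𝓘(ℂ, F) 𝓘(ℂ, E) ω d)
    (hinv : ∀ (q : Q) (g : G), d (q <• g) = d q) :
    ∃ u : X → G, ContMDiff 𝓘(ℂ) 𝓘(ℂ, E) ω u ∧ ∀ q, d q = u (π q) := by
  have key (a b : Q) (hab : π a = π b) : d a = d b := by
    obtain ⟨g, rfl⟩ := hπ.exists_eq_smul hab
    exact hinv b g
  -- The chosen preimages need not vary continuously; by `key` they may be replaced locally by the
  -- section `y ↦ Φ.symm (y, 1)`.
  refine ⟨fun x => d (Function.surjInv hπ.surjective x), fun x => ?_,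
    fun q => key _ _ (Function.surjInv_eq hπ.surjective _).symm⟩
  obtain ⟨U, Φ, hU, hxU, -, ht, -, hΦ, h1, -⟩ := hπ.locally_trivial x
  have hmem {y : X} (hy : y ∈ U) : (y, (1 : G)) ∈ Φ.target := by rw [ht]; exact ⟨hy, trivial⟩
  have hsec : ContMDiffAt 𝓘(ℂ) 𝓘(ℂ, F) ω (fun y => Φ.symm (y, 1)) x :=
    (hΦ.contMDiffAt (Φ.open_target.mem_nhds (hmem hxU))).comp x
      (contMDiffAt_id.prodMk contMDiffAt_const)
  refine (hd.contMDiffAt.comp x hsec).congr_of_eventuallyEq ?_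
  filter_upwards [hU.mem_nhds hxU] with y hy
  refine key _ _ ?_
  rw [Function.surjInv_eq hπ.surjective, ← h1 _ (Φ.map_target (hmem hy)), Φ.right_inv (hmem hy)]

/-- Two holomorphic maps to a principal bundle with structure group `(ℂ*)ᵖ` over a compact
connected base which lie over the same map and are equivariant through the same map `ψ` differ by
a constant. -/
theorem exists_const_eq_smul [IsManifold 𝓘(ℂ) ω X] [CompactSpace X] [ConnectedSpace X]
    [LieGroup 𝓘(ℂ, E) ω G] (hG : IsComplexTorus E G)
    (hπ : IsHolomorphicPrincipalBundle E F G π) {a b : Q → Q} {ψ : G → G}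
    (ha : ContMDiff 𝓘(ℂ, F) 𝓘(ℂ, F) ω a) (hb : ContMDiff 𝓘(ℂ, F) 𝓘(ℂ, F) ω b)
    (hab : ∀ q, π (a q) = π (b q))
    (haψ : ∀ (q : Q) (g : G), a (q <• g) = a q <• ψ g)
    (hbψ : ∀ (q : Q) (g : G), b (q <• g) = b q <• ψ g) :
    ∃ g : G, ∀ q, a q = b q <• g := by
  choose d hd using fun q => hπ.exists_eq_smul (hab q)
  have hinv (q : Q) (g : G) : d (q <• g) = d q := by
    refine hπ.smul_left_injective (b (q <• g)) ?_
    change b (q <• g) <• d (q <• g) = b (q <• g) <• d q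
    rw [← hd, haψ, hbψ, hd, ← op_smul_mul, ← op_smul_mul, mul_comm]
  obtain ⟨u, hu, hdu⟩ :=
    hπ.exists_contMDiff_comp_proj (hπ.contMDiff_of_eq_smul ha hb hd) hinv
  obtain ⟨x⟩ := (inferInstance : Nonempty X)
  exact ⟨u x, fun q => by rw [hG.apply_eq_of_contMDiff hu x (π q), ← hdu, ← hd]⟩

end IsHolomorphicPrincipalBundle

end Bundle

/-! ### Twisting by 1-cocycles -/

namespace TwistedStructure

section Algebra

variable {X Γ G F Q : Type*} [Group Γ] [MulAction Γᵐᵒᵖ X] [CommGroup G]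
  [NormedAddCommGroup F] [NormedSpace ℂ F]
  [TopologicalSpace Q] [ChartedSpace F Q] [MulAction Gᵐᵒᵖ Q]
  {π : Q → X} {θ : Γ →* MulAut G} {c : Γ → Γ → G}

theorem act_smul_theta (s : TwistedStructure F π θ c) (q : Q) (g : G) (γ : Γ) :
    s.act (q <• θ γ g) γ = s.act q γ <• g := by
  rw [s.act_smul, MulAut.inv_apply_self]

/-- Acting by `γ` and then `γ⁻¹` is not the identity but translation by `c γ γ⁻¹`, which is still
injective. -/
theorem act_injective (s : TwistedStructure F π θ c) (γ : Γ) : Function.Injective fun q => s.act q γ := by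
  intro q q' h
  have h' := congrArg (fun q => s.act q γ⁻¹) h
  simp only [s.act_act, mul_inv_cancel, s.act_one] at h'
  exact MulAction.injective _ h'

end Algebra

variable {X : Type*} [TopologicalSpace X] [ChartedSpace ℂ X]
  {Γ : Type*} [Group Γ] [MulAction Γᵐᵒᵖ X]
  {E : Type*} [NormedAddCommGroup E] [NormedSpace ℂ E]
  {G : Type*} [TopologicalSpace G] [ChartedSpace E G] [CommGroup G]
  {F : Type*} [NormedAddCommGroup F] [NormedSpace ℂ F]
  {Q : Type*} [TopologicalSpace Q] [ChartedSpace F Q] [MulAction Gᵐᵒᵖ Q]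
  {π : Q → X} {θ : Γ →* MulAut G} {c : Γ → Γ → G}

theorem act_smul_injective (hπ : IsHolomorphicPrincipalBundle E F G π)
    (s : TwistedStructure F π θ c) (q : Q) (γ : Γ) :
    Function.Injective fun g : G => s.act (q <• g) γ :=
  (s.act_injective γ).comp (hπ.smul_left_injective q)

/-- The twist of a structure `•` by a 1-cocycle `κ`, given by `q * γ = (q κ(γ)) • γ`. -/
def twist (hπ : IsHolomorphicPrincipalBundle E F G π) (κ : Z1 θ)
    (s : TwistedStructure F π θ c) : TwistedStructure F π θ c where
  act q γ := s.act (q <• κ.1 γ) γ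
  holomorphic γ := (s.holomorphic γ).comp (hπ.contMDiff_smul_const (κ.1 γ))
  act_one q := by rw [Z1.map_one, op_one, one_smul, s.act_one]
  act_smul q g γ := by
    rw [← s.act_smul, ← op_smul_mul, ← op_smul_mul, mul_comm]
  act_act q γ γ' := by
    -- Moving `κ(γ')` inside the action of `γ` turns it into `θ_γ(κ(γ'))`, the factor that the
    -- cocycle identity requires.
    rw [← s.act_smul_theta, s.act_act, Z1.map_mul]
    simp only [← op_smul_mul]
    congr 3
    rw [mul_comm]
  proj_act q γ := by rw [s.proj_act, hπ.proj_smul]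

theorem twist_isomorphic (hπ : IsHolomorphicPrincipalBundle E F G π) (κ : Z1 θ)
    {s t : TwistedStructure F π θ c} (h : s.Isomorphic t) :
    (s.twist hπ κ).Isomorphic (t.twist hπ κ) := by
  obtain ⟨f, h1, h2, h3⟩ := h
  exact ⟨f, h1, h2, fun q γ => by simp only [twist, h3, h2]⟩

/-- The automorphism of a principal bundle given by an element of the abelian group `G`. -/
def smulDiffeomorph (hπ : IsHolomorphicPrincipalBundle E F G π) (g : G) :
    Q ≃ₘ^ω⟮𝓘(ℂ, F), 𝓘(ℂ, F)⟯ Q where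
  toEquiv := MulAction.toPerm (op g)
  contMDiff_toFun := hπ.contMDiff_smul_const g
  contMDiff_invFun := hπ.contMDiff_smul_const g⁻¹

/-- Twisting by a coboundary does not change the isomorphism class. -/
theorem isomorphic_twist_of_eq (hπ : IsHolomorphicPrincipalBundle E F G π) {κ κ' : Z1 θ} {g : G}
    (hg : ∀ γ, κ'.1 γ = g⁻¹ * κ.1 γ * θ γ g) (s : TwistedStructure F π θ c) :
    (s.twist hπ κ).Isomorphic (s.twist hπ κ') := by
  refine ⟨smulDiffeomorph hπ g, fun q => hπ.proj_smul q g, fun q h => ?_, fun q γ => ?_⟩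
  · change (q <• h) <• g = (q <• g) <• h
    rw [← op_smul_mul, ← op_smul_mul, mul_comm]
  · change s.act (q <• κ.1 γ) γ <• g = s.act ((q <• g) <• κ'.1 γ) γ
    rw [← s.act_smul_theta, ← op_smul_mul, ← op_smul_mul, hg, mul_assoc g⁻¹, mul_inv_cancel_left]

section Compact

variable [IsManifold 𝓘(ℂ) ω X] [CompactSpace X] [ConnectedSpace X] [LieGroup 𝓘(ℂ, E) ω G]

/-- Isomorphic twists of a structure come from cohomologous cocycles. -/
theorem mk_eq_mk_of_isomorphic_twist (hG : IsComplexTorus E G)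
    (hπ : IsHolomorphicPrincipalBundle E F G π) {κ κ' : Z1 θ} {s : TwistedStructure F π θ c}
    (h : (s.twist hπ κ).Isomorphic (s.twist hπ κ')) : H1.mk θ κ = H1.mk θ κ' := by
  obtain ⟨f, h1, h2, h3⟩ := h
  -- Comparison of `f` with the identity: `f` is translation by a constant `g`.
  obtain ⟨g, hg⟩ := hπ.exists_const_eq_smul hG (b := id) (ψ := id) f.contMDiff contMDiff_id h1 h2
    fun _ _ => rfl
  obtain ⟨x⟩ := (inferInstance : Nonempty X)
  obtain ⟨q, -⟩ := hπ.surjective x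
  refine (H1.mk_eq_mk_iff θ κ κ').2 ⟨g, fun γ => ?_⟩
  have h := h3 q γ
  simp only [hg, id, twist, ← s.act_smul_theta, ← op_smul_mul] at h
  rw [mul_assoc, s.act_smul_injective hπ q γ h, inv_mul_cancel_left]

/-- Any two structures differ by the twist by a 1-cocycle. -/
theorem exists_twist_eq (hG : IsComplexTorus E G)
    (hπ : IsHolomorphicPrincipalBundle E F G π) (s t : TwistedStructure F π θ c) :
    ∃ κ : Z1 θ, s.twist hπ κ = t := by
  have H (γ : Γ) : ∃ g : G, ∀ q, t.act q γ = s.act (q <• g) γ := by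
    obtain ⟨g, hg⟩ := hπ.exists_const_eq_smul hG (t.holomorphic γ) (s.holomorphic γ)
      (fun q => by rw [t.proj_act, s.proj_act]) (fun q g => t.act_smul q g γ)
      fun q g => s.act_smul q g γ
    -- The constant `g` stands outside the action; inside it becomes `θ_γ(g)`.
    exact ⟨θ γ g, fun q => by rw [s.act_smul_theta, hg]⟩
  choose κ hκ using H
  obtain ⟨x⟩ := (inferInstance : Nonempty X)
  obtain ⟨q, -⟩ := hπ.surjective x
  refine ⟨⟨κ, fun γ γ' => ?_⟩, ?_⟩
  · have h := t.act_act q γ γ'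
    rw [hκ, hκ, hκ, ← s.act_smul_theta, s.act_act] at h
    simp only [← op_smul_mul] at h
    have h' := s.act_smul_injective hπ q (γ * γ') h
    rw [mul_comm] at h'
    -- The common factor `c γ γ'` cancels.
    exact (mul_left_cancel h').symm
  · ext q γ
    exact (hκ γ q).symm

end Compact

end TwistedStructure

/-! ### The action of the cohomology group on isomorphism classes -/

section Action

variable {X : Type*} [TopologicalSpace X] [ChartedSpace ℂ X]
  {Γ : Type*} [Group Γ] [MulAction Γᵐᵒᵖ X]
  {E : Type*} [NormedAddCommGroup E] [NormedSpace ℂ E]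
  {G : Type*} [TopologicalSpace G] [ChartedSpace E G] [CommGroup G]
  {F : Type*} [NormedAddCommGroup F] [NormedSpace ℂ F]
  {Q : Type*} [TopologicalSpace Q] [ChartedSpace F Q] [MulAction Gᵐᵒᵖ Q]
  {π : Q → X}

/-- The action of `H¹_θ(Γ, G)` on isomorphism classes by twisting. -/
abbrev IsoClasses.mulAction (hπ : IsHolomorphicPrincipalBundle E F G π)
    (θ : Γ →* MulAut G) (c : Γ → Γ → G) : MulAction (H1 θ) (IsoClasses F π θ c) where
  smul := Quotient.map₂ (TwistedStructure.twist hπ) fun κ κ' hκ s t hst => by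
    obtain ⟨g, hg⟩ := (H1.mk_eq_mk_iff θ κ κ').1 (Quotient.sound hκ)
    exact (TwistedStructure.setoid F π θ c).trans
      (TwistedStructure.isomorphic_twist_of_eq hπ hg s) (TwistedStructure.twist_isomorphic hπ κ' hst)
  one_smul := by
    rintro ⟨s⟩
    refine congrArg IsoClasses.mk (TwistedStructure.ext ?_)
    funext q γ
    change s.act (q <• (1 : G)) γ = s.act q γ
    rw [op_one, one_smul]
  mul_smul := by
    rintro ⟨κ⟩ ⟨κ'⟩ ⟨s⟩
    refine congrArg IsoClasses.mk (TwistedStructure.ext ?_)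
    funext q γ
    change s.act (q <• (κ.1 γ * κ'.1 γ)) γ = s.act ((q <• κ.1 γ) <• κ'.1 γ) γ
    rw [op_smul_mul]

end Action

end TwistedEquivariant

open TwistedEquivariant in
theorem mainTheorem11
    -- `X` is a compact connected Riemann surface
    {X : Type*} [TopologicalSpace X] [ChartedSpace ℂ X] [IsManifold 𝓘(ℂ) ω X]
    [T2Space X] [CompactSpace X] [ConnectedSpace X]
    -- `Γ` is a finite group acting on `X` on the right by holomorphic automorphisms
    {Γ : Type*} [Group Γ] [Finite Γ] [MulAction Γᵐᵒᵖ X]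
    (hΓ : ∀ γ : Γ, ContMDiff 𝓘(ℂ) 𝓘(ℂ) ω (fun x : X => x <• γ))
    -- `G` is a complex Lie group isomorphic to `(ℂ*)ᵖ`
    {E : Type*} [NormedAddCommGroup E] [NormedSpace ℂ E]
    {G : Type*} [TopologicalSpace G] [ChartedSpace E G] [CommGroup G]
    [LieGroup 𝓘(ℂ, E) ω G] (hG : IsComplexTorus E G)
    -- `θ` is a homomorphism from `Γ` to the group of automorphisms of the complex Lie group `G`
    (θ : Γ →* MulAut G) (hθ : ∀ γ, ContMDiff 𝓘(ℂ, E) 𝓘(ℂ, E) ω (θ γ))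
    (c : Γ → Γ → G) (hc : IsTwoCocycle θ c)
    -- `π : Q → X` is a holomorphic principal `G`-bundle
    {F : Type*} [NormedAddCommGroup F] [NormedSpace ℂ F]
    {Q : Type*} [TopologicalSpace Q] [ChartedSpace F Q] [IsManifold 𝓘(ℂ, F) ω Q]
    [MulAction Gᵐᵒᵖ Q] (π : Q → X) (hπ : IsHolomorphicPrincipalBundle E F G π) :
    IsEmpty (IsoClasses F π θ c) ∨
      Nonempty (IsoClasses F π θ c) ∧
      ∃ _ : MulAction (H1 θ) (IsoClasses F π θ c),
        -- the action is induced by `q * γ = (q κ(γ)) • γ`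
        (∀ (κ : Z1 θ) (s : TwistedStructure F π θ c), ∃ t : TwistedStructure F π θ c,
          (∀ (q : Q) (γ : Γ), t.act q γ = s.act (q <• κ.1 γ) γ) ∧
          H1.mk θ κ • IsoClasses.mk s = IsoClasses.mk t) ∧
        -- the action is simply transitive
        ∀ a b : IsoClasses F π θ c, ∃! h : H1 θ, h • a = b := by
  rcases isEmpty_or_nonempty (IsoClasses F π θ c) with h | h
  · exact Or.inl h
  refine Or.inr ⟨h, IsoClasses.mulAction hπ θ c, fun κ s => ⟨s.twist hπ κ, fun _ _ => rfl, rfl⟩, ?_⟩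
  rintro ⟨s⟩ ⟨t⟩
  obtain ⟨κ, rfl⟩ := s.exists_twist_eq hG hπ t
  refine ⟨H1.mk θ κ, rfl, ?_⟩
  rintro ⟨κ'⟩ hκ'
  exact TwistedStructure.mk_eq_mk_of_isomorphic_twist hG hπ (Quotient.exact hκ')
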